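/- Let $d\ge 2$, $\mathcal X=[0,1]^d$ with Lebesgue measure $\lambda$, and write $\bm x^{(d)}=(x_1,\dots,x_{d-1})$. Let $\alpha\in(0,1]$, $\gamma\ge\alpha$, $\widetilde\gamma=\gamma/\alpha$, $n\in\mathbb N$. Let $\mathscr C$ be a class of continuous functions $[0,1]^{d-1}\to[0,1]$ such that for each $b\in\mathscr C$ there is $K_b>0$ with $|b(\bm z)-b(\bm w)|\le K_b\|\bm z-\bm w\|_2^\alpha$ for all $\bm z,\bm w\in[0,1]^{d-1}$. For $b\in\mathscr C$ let $h_b:\mathcal X\to\{0,1\}$, $h_b(\bm x)=1$ if $b(\bm x^{(d)})\le x_d$ and $h_b(\bm x)=0$ otherwise, with decision boundary $\partial\Omega_{h_b}=\{\bm x\in\mathcal X: b(\bm x^{(d)})=x_d\}$. Let $\mathcal P_{\mathscr C}$ be the set of pairs $(h,\mu)$ with $h=h_b$ for some $b\in\mathscr C$ and $\mu$ a probability measure on $\mathcal X$ having an essentially bounded density with respect to $\lambda$, for which there is a constant $C>0$ (possibly depending on the pair) with $$\mu\big(\{\bm x\in\mathcal X:\operatorname{dist}(\bm x,\partial\Omega_h)\le\varepsilon\}\big)\le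 C\varepsilon^\gamma\qquad\text{for all }\varepsilon>0,$$ where $\operatorname{dist}$ is the Euclidean distance. The noiseless minimax risk is $$\mathcal I_n(\mathscr C)=\inf_A\ \sup_{(h,\mu)\in\mathcal P_{\mathscr C}}\ \mathbb E\,\|A(\bm S_n)-h\|_{L^2(\mu)}^2,$$ where $A$ ranges over all measurable maps $(\mathcal X\times\{0,1\})^n\to L^2(\lambda)$, and $\bm S_n=((\bm x_i,h(\bm x_i)))_{i=1}^n$ with $\bm x_1,\dots,\bm x_n$ i.i.d. with law $\mu$. Let $M\ge2$ be an even integer, $b_0\in\mathscr C$, and $K_\varphi,C_\varphi,C_{\mathscr C}>0$. Let $\varphi:\mathbb R^{d-1}\to[0,1]$ satisfy $\varphi(\bm 0)=1$, $\operatorname{supp}\varphi\subset(-1,1)^{d-1}$, $|\varphi(\bm z)-\varphi(\bm w)|\le K_\varphi\|\bm z-\bm w\|_2^\alpha$ and $|\varphi(\bm z)-\varphi(\bm 0)|\le C_\varphi\|\bm z\|_\infty^\alpha$ for all $\bm z,\bm w\in\mathbb R^{d-1}$. Suppose that $$C_{\mathscr C}\le M^{-\alpha}/4\quad\text{and}\quad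 C_{\mathscr C}\le b_0(\bm z)\le 1-3C_{\mathscr C}\quad\text{for all }\bm z\in[0,1]^{d-1}.$$ Let $\bm v_1,\dots,\bm v_m$, $m=(M/2)^{d-1}$, enumerate $\{1,3,\dots,M-1\}^{d-1}$, let $\varphi_j(\bm z)=\varphi(M(\bm z-\bm v_j/M))$, and let $$\mathscr C_\Theta=\Big\{b_0+C_{\mathscr C}\sum_{j=1}^m\theta_j\varphi_j\ :\ \theta\in\{0,1\}^m\Big\},$$ a family of functions on $[0,1]^{d-1}$. If $\mathscr C_\Theta\subseteq\mathscr C$ and $2^{\widetilde\gamma+6}\,n\,C_{\mathscr C}^{\widetilde\gamma}M^{-(d-1)}\le1$, then $$\mathcal I_n(\mathscr C)\ \ge\ \frac{r^{d-1}}{8^{\widetilde\gamma+2}}\,C_{\mathscr C}^{\widetilde\gamma},\qquad r=\min\{1,(2C_\varphi)^{-1/\alpha}\}.$$ -/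

import Mathlib

open MeasureTheory Set
open scoped ENNReal

noncomputable section

/-! Throughout, the ambient dimension is `d = k + 1`, so that `k = d - 1`. -/

/-- The unit cube `[0,1]^d`, with the Euclidean metric and its Borel sets. -/
def unitCube (d : ℕ) : Set (EuclideanSpace ℝ (Fin d)) :=
  {x | ∀ i, x i ∈ Icc (0 : ℝ) 1}

/-- Lebesgue measure on `[0,1]^d`. -/
def cubeVolume (d : ℕ) : Measure (unitCube d) :=
  Measure.comap Subtype.val volume

/-- The first `d - 1` coordinates `(x₁, …, x_{d-1})` of a point of `[0,1]^d`. -/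
def baseCoord {k : ℕ} (x : unitCube (k + 1)) : unitCube k :=
  ⟨WithLp.toLp 2 fun i => x.1 i.castSucc, fun i => x.2 i.castSucc⟩

/-- The last coordinate `x_d` of a point of `[0,1]^d`. -/
def lastCoord {k : ℕ} (x : unitCube (k + 1)) : ℝ := x.1 (Fin.last k)

open Classical in
/-- The horizon function `h_b : [0,1]^d → {0,1}`, equal to `1` exactly when
`b (x₁, …, x_{d-1}) ≤ x_d`. -/
def horizon {k : ℕ} (b : unitCube k → ℝ) (x : unitCube (k + 1)) : Fin 2 :=
  if b (baseCoord x) ≤ lastCoord x then 1 else 0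

/-- The decision boundary of the classifier `h_b`: the graph of `b` inside `[0,1]^d`. -/
def decisionBoundary {k : ℕ} (b : unitCube k → ℝ) : Set (unitCube (k + 1)) :=
  {x | b (baseCoord x) = lastCoord x}

/-- `𝒞` is a class of continuous functions from `[0,1]^{d-1}` to `[0,1]`. -/
def IsHorizonClass {k : ℕ} (𝒞 : Set (unitCube k → ℝ)) : Prop :=
  ∀ b ∈ 𝒞, Continuous b ∧ ∀ z, b z ∈ Icc (0 : ℝ) 1

/-- Every `b ∈ 𝒞` is `α`-Hölder for the Euclidean norm, with a constant that may depend on `b`. -/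
def IsHolderClass {k : ℕ} (𝒞 : Set (unitCube k → ℝ)) (α : ℝ) : Prop :=
  ∀ b ∈ 𝒞, ∃ K : ℝ, 0 < K ∧ ∀ z w : unitCube k, |b z - b w| ≤ K * ‖z.1 - w.1‖ ^ α

/-- The pair `(h_b, μ)` satisfies the geometric margin condition with exponent `γ`. -/
def MarginCondition {k : ℕ} (γ : ℝ) (b : unitCube k → ℝ) (μ : Measure (unitCube (k + 1))) :
    Prop :=
  ∃ C : ℝ, 0 < C ∧ ∀ ε : ℝ, 0 < ε →
    μ {x | Metric.infDist x (decisionBoundary b) ≤ ε} ≤ ENNReal.ofReal (C * ε ^ γ)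

/-- The probability measures on `[0,1]^d` with an essentially bounded density with respect to
Lebesgue measure. -/
def boundedDensityMeasures (d : ℕ) : Set (Measure (unitCube d)) :=
  {μ | ∃ f : unitCube d → ℝ, (∀ x, 0 ≤ f x) ∧ MemLp f ∞ (cubeVolume d) ∧
    ∫ x, f x ∂(cubeVolume d) = 1 ∧ μ = (cubeVolume d).withDensity fun x => ENNReal.ofReal (f x)}

/-- All pairs `(h, μ)` of a horizon classifier `h = h_b`, `b ∈ 𝒞`, and a marginal distribution
`μ` with bounded density that satisfy the margin condition with exponent `γ`. -/
def admissiblePairs {k : ℕ} (𝒞 : Set (unitCube k → ℝ)) (γ : ℝ) :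
    Set ((unitCube (k + 1) → Fin 2) × Measure (unitCube (k + 1))) :=
  {p | ∃ b ∈ 𝒞, p.1 = horizon b ∧ p.2 ∈ boundedDensityMeasures (k + 1) ∧
    MarginCondition γ b p.2}

/-- The space `Λⁿ`, `Λ = [0,1]^d × {0,1}`, of labelled samples of size `n`. -/
abbrev SampleSpace (d n : ℕ) : Type := Fin n → unitCube d × Fin 2

/-- The learning algorithms: the maps `Λⁿ → L²(λ)` that are measurable for the Borel
σ-algebra of the Hilbert space `L²(λ)`. -/
def algorithms (d n : ℕ) :
    Set (SampleSpace d n → Lp ℝ 2 (cubeVolume d)) :=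
  {A | @Measurable _ _ MeasurableSpace.pi (borel _) A}

/-- The joint law on `[0,1]^d × {0,1}` of a noiseless labelled input `(x, h x)`, `x ∼ μ`. -/
def jointLaw {d : ℕ} (h : unitCube d → Fin 2) (μ : Measure (unitCube d)) :
    Measure (unitCube d × Fin 2) :=
  μ.map fun x => (x, h x)

/-- The expected squared `L²(μ)` error of the algorithm `A` at `(h, μ)`, the expectation being
over an i.i.d. noiseless sample of size `n`. -/
def risk {d n : ℕ} (A : SampleSpace d n → Lp ℝ 2 (cubeVolume d))
    (h : unitCube d → Fin 2) (μ : Measure (unitCube d)) : ℝ≥0∞ :=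
  ∫⁻ S, eLpNorm (fun x => A S x - ((h x : ℕ) : ℝ)) 2 μ ^ 2
    ∂(Measure.pi fun _ : Fin n => jointLaw h μ)

/-- The minimax risk `I_n(𝒞)` for margin exponent `γ`, an element of `[0, ∞]`. -/
def minimaxRisk {k : ℕ} (n : ℕ) (𝒞 : Set (unitCube k → ℝ)) (γ : ℝ) : ℝ≥0∞ :=
  ⨅ A ∈ algorithms (k + 1) n, ⨆ p ∈ admissiblePairs 𝒞 γ, risk A p.1 p.2

/-- The grid `{1, 3, …, M - 1}^{d-1}` (for even `M`); it has `(M / 2)^{d-1}` elements. -/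
def oddGrid (k M : ℕ) : Finset (Fin k → ℕ) :=
  Fintype.piFinset fun _ => (Finset.Icc 1 M).filter Odd

/-- The localized bump `z ↦ φ (M (z - v / M))` on `[0,1]^{d-1}`. -/
def localBump {k : ℕ} (M : ℕ) (φ : EuclideanSpace ℝ (Fin k) → ℝ) (v : Fin k → ℕ)
    (z : unitCube k) : ℝ :=
  φ (WithLp.toLp 2 fun i => (M : ℝ) * (z.1 i - (v i : ℝ) / (M : ℝ)))

/-- The perturbed function `b_θ = b₀ + C ∑_v θ_v φ_v`; the binary vector `θ` is indexed by the
points `v` of the odd grid. -/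
def perturbed {k : ℕ} (M : ℕ) (b₀ : unitCube k → ℝ) (φ : EuclideanSpace ℝ (Fin k) → ℝ) (C : ℝ)
    (θ : oddGrid k M → Fin 2) (z : unitCube k) : ℝ :=
  b₀ z + ∑ v : oddGrid k M, ((θ v : ℕ) : ℝ) * (C * localBump M φ v.1 z)

/-- The finite family `{b_θ | θ ∈ {0,1}^m}`. -/
def perturbedFamily {k : ℕ} (M : ℕ) (b₀ : unitCube k → ℝ) (φ : EuclideanSpace ℝ (Fin k) → ℝ)
    (C : ℝ) : Set (unitCube k → ℝ) :=
  Set.range (perturbed M b₀ φ C)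

/-- The data (even grid size `M`, baseline `b₀`, bump `φ` with Hölder constants `Kφ` and `Cφ`,
amplitude `C`) meet the requirements of the localized-perturbation construction. -/
structure IsPerturbationData {k : ℕ} (𝒞 : Set (unitCube k → ℝ)) (α : ℝ) (M : ℕ)
    (b₀ : unitCube k → ℝ) (φ : EuclideanSpace ℝ (Fin k) → ℝ) (Kφ Cφ C : ℝ) : Prop where
  even_M : Even M
  two_le_M : 2 ≤ M
  baseline_mem : b₀ ∈ 𝒞
  Kφ_pos : 0 < Kφ
  holder : ∀ z w, |φ z - φ w| ≤ Kφ * ‖z - w‖ ^ α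
  Cφ_pos : 0 < Cφ
  /-- Hölder continuity at `0`; the norm of `WithLp.ofLp z : Fin k → ℝ` is the sup norm. -/
  holder_zero : ∀ z, |φ z - φ 0| ≤ Cφ * ‖WithLp.ofLp z‖ ^ α
  tsupport_subset : tsupport φ ⊆ {z | ∀ i, z i ∈ Ioo (-1 : ℝ) 1}
  map_zero : φ 0 = 1
  range_mem : ∀ z, φ z ∈ Icc (0 : ℝ) 1
  amplitude_pos : 0 < C
  amplitude_le : C ≤ (M : ℝ) ^ (-α) / 4
  baseline_range : ∀ z, b₀ z ∈ Icc C (1 - 3 * C)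

end

open MeasureTheory Set
open scoped ENNReal

/-! The bound is an Assouad hypercube argument with a single input law `μ` shared by all `θ`. Over
each grid point lies an anchor halfway between the two values that the perturbed boundaries take
there, so its label is decided by one bit of `θ`. One further anchor lies below every graph and
always has label `0`. Spread mass `p` over a tiny ball around each bit anchor and the remaining mass
over a ball around the extra one.

The margin constant may depend on the pair, so the condition costs nothing: the balls keep distance
at least `ρ` from all of the finitely many graphs, and `ρ ^ (-γ)` serves as constant. Hence `p` is
constrained only by `m * p ≤ 1`.

With probability at least `(1 - p) ^ n` the sample carries no information on bit `j`, and any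
prediction then loses on average at least `1/4` on ball `j`. Summing over `j` gives `m * p * (1 - p)
^ n / 4` (`assouad_noiseless`, `le_minimaxRisk_of_anchors`). The choice `p = C ^ (γ / α) * M ^ (-k)`
gives `m * p = C ^ (γ / α) / 2 ^ k` and `n * p ≤ 1/2`. Since `r ≤ 1/2` (`radius_le_half`), the
factor `r ^ k` is at most `2 ^ (-k)`. -/

/-! ### Assouad's lemma for noiseless labels. -/

theorem half_le_enorm_sq_add (a : ℝ) :
    (2 : ℝ≥0∞)⁻¹ ≤ ‖a - ((0 : ℕ) : ℝ)‖ₑ ^ 2 + ‖a - ((1 : ℕ) : ℝ)‖ₑ ^ 2 := by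
  have h : ∀ b : ℝ, ‖b‖ₑ ^ 2 = ENNReal.ofReal (b ^ 2) := fun b => by
    rw [← ofReal_norm, ← ENNReal.ofReal_pow (norm_nonneg _), Real.norm_eq_abs, sq_abs]
  rw [h, h, ← ENNReal.ofReal_add (by positivity) (by positivity),
    show (2 : ℝ≥0∞)⁻¹ = ENNReal.ofReal (2⁻¹ : ℝ) by
      rw [ENNReal.ofReal_inv_of_pos two_pos, ENNReal.ofReal_ofNat]]
  apply ENNReal.ofReal_le_ofReal
  push_cast
  -- The sum `a ^ 2 + (a - 1) ^ 2` is smallest at `a = 1/2`.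
  nlinarith [sq_nonneg (2 * a - 1)]

theorem half_le_enorm_sq_add_of_ne (a : ℝ) {u v : Fin 2} (h : u ≠ v) :
    (2 : ℝ≥0∞)⁻¹ ≤ ‖a - ((u : ℕ) : ℝ)‖ₑ ^ 2 + ‖a - ((v : ℕ) : ℝ)‖ₑ ^ 2 := by
  have := half_le_enorm_sq_add a
  fin_cases u <;> fin_cases v
  · exact absurd rfl h
  · exact this
  · rw [add_comm]; exact this
  · exact absurd rfl h

theorem eLpNorm_two_sq {X : Type*} [MeasurableSpace X] (g : X → ℝ) (μ : Measure X) :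
    eLpNorm g 2 μ ^ 2 = ∫⁻ x, ‖g x‖ₑ ^ 2 ∂μ := by
  have := eLpNorm_nnreal_pow_eq_lintegral (μ := μ) (f := g) (p := 2) two_ne_zero
  simpa using this

/-- The squared distance to a fixed bounded function in `L²(μ)` is continuous on `L²(ν)` when `μ`
is dominated by a multiple of `ν`. -/
theorem continuous_eLpNorm_sub_sq {X : Type*} [MeasurableSpace X] {μ ν : Measure X} {K : ℝ≥0∞}
    (hK : K ≠ ∞) (hμ : μ ≤ K • ν) {g : X → ℝ} (hg : Measurable g) :
    Continuous fun f : Lp ℝ 2 ν => eLpNorm (fun x => f x - g x) 2 μ ^ 2 := by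
  have hac : μ ≪ ν := Measure.absolutelyContinuous_of_le_smul hμ
  refine (ENNReal.continuous_pow 2).comp
    (continuous_of_le_add_edist (K ^ (1 / (2 : ℝ≥0∞)).toReal) ?_ fun f f' => ?_)
  · exact ENNReal.rpow_ne_top_of_nonneg ENNReal.toReal_nonneg hK
  · have hf := (Lp.aestronglyMeasurable f).mono_ac hac
    have hf' := (Lp.aestronglyMeasurable f').mono_ac hac
    have hsplit : (fun x => f x - g x) = (fun x => f' x - g x) + (⇑f - ⇑f') := by
      ext x; simp
    calc eLpNorm (fun x => f x - g x) 2 μ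
        ≤ eLpNorm (fun x => f' x - g x) 2 μ + eLpNorm (⇑f - ⇑f') 2 μ := by
          rw [hsplit]
          exact eLpNorm_add_le (hf'.sub hg.aestronglyMeasurable) (hf.sub hf') one_le_two
      _ ≤ _ := by
          gcongr
          calc eLpNorm (⇑f - ⇑f') 2 μ ≤ eLpNorm (⇑f - ⇑f') 2 (K • ν) :=
                eLpNorm_mono_measure _ hμ
            _ ≤ K ^ (1 / (2 : ℝ≥0∞)).toReal * eLpNorm (⇑f - ⇑f') 2 ν := by
                rw [eLpNorm_smul_measure_of_ne_top (by simp), smul_eq_mul]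
            _ = _ := by rw [Lp.edist_def]

/-- For noiseless labels, the risk is an expectation over the unlabelled sample. -/
theorem risk_eq_lintegral {d n : ℕ} {A : SampleSpace d n → Lp ℝ 2 (cubeVolume d)}
    (hA : A ∈ algorithms d n) {h : unitCube d → Fin 2} (hh : Measurable h)
    {μ : Measure (unitCube d)} [IsProbabilityMeasure μ] {K : ℝ≥0∞} (hK : K ≠ ∞)
    (hμ : μ ≤ K • cubeVolume d) :
    Measurable (fun S : SampleSpace d n =>
      eLpNorm (fun x => A S x - ((h x : ℕ) : ℝ)) 2 μ ^ 2) ∧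
    risk A h μ = ∫⁻ x : Fin n → unitCube d,
      eLpNorm (fun y => A (fun i => (x i, h (x i))) y - ((h y : ℕ) : ℝ)) 2 μ ^ 2
        ∂(Measure.pi fun _ => μ) := by
  have hg : Measurable fun x => ((h x : ℕ) : ℝ) :=
    (measurable_of_countable (fun u : Fin 2 => ((u : ℕ) : ℝ))).comp hh
  have hpair : Measurable fun x => (x, h x) := measurable_id.prodMk hh
  have hmeas : Measurable (fun S : SampleSpace d n =>
      eLpNorm (fun x => A S x - ((h x : ℕ) : ℝ)) 2 μ ^ 2) := by
    have hc := continuous_eLpNorm_sub_sq hK hμ hg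
    let : MeasurableSpace (Lp ℝ 2 (cubeVolume d)) := borel _
    have : BorelSpace (Lp ℝ 2 (cubeVolume d)) := ⟨rfl⟩
    exact hc.measurable.comp (show Measurable A from hA)
  refine ⟨hmeas, ?_⟩
  have hmap : (Measure.pi fun _ : Fin n => jointLaw h μ)
      = (Measure.pi fun _ : Fin n => μ).map fun x i => (x i, h (x i)) := by
    unfold jointLaw
    have : IsProbabilityMeasure (μ.map fun x => (x, h x)) :=
      Measure.isProbabilityMeasure_map hpair.aemeasurable
    exact (Measure.pi_map_pi (μ := fun _ : Fin n => μ) (f := fun _ x => (x, h x))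
      fun _ => hpair.aemeasurable).symm
  rw [risk, hmap, lintegral_map hmeas]
  exact measurable_pi_lambda _ fun i => hpair.comp (measurable_pi_apply i)

/-- Assouad's lemma for noiseless labels: if `μ` has mass at least `p` on each set `V j`, the label
on `V j` is governed by the bit `θ j` alone, and with probability at least `q` a sample point
misses `V j`, then some `θ` has risk at least `m p qⁿ / 4`. -/
theorem assouad_noiseless {d n : ℕ} {J : Type*} [Fintype J] [DecidableEq J]
    {A : SampleSpace d n → Lp ℝ 2 (cubeVolume d)} (hA : A ∈ algorithms d n)
    {h : (J → Fin 2) → unitCube d → Fin 2} (hh : ∀ θ, Measurable (h θ))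
    {μ : Measure (unitCube d)} [IsProbabilityMeasure μ] {K : ℝ≥0∞} (hK : K ≠ ∞)
    (hμ : μ ≤ K • cubeVolume d) {ν : J → Measure (unitCube d)} {p q B : ℝ≥0∞}
    (hν : ∀ j, IsProbabilityMeasure (ν j)) (hνμ : p • ∑ j, ν j ≤ μ)
    (hflip : ∀ θ θ' j, θ j ≠ θ' j → ∀ᵐ x ∂(ν j), h θ x ≠ h θ' x)
    {W : J → Set (unitCube d)} (hW : ∀ j, MeasurableSet (W j)) (hq : ∀ j, q ≤ μ (W j))
    (hagree : ∀ θ j u, ∀ x ∈ W j, h (Function.update θ j u) x = h θ x)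
    (hB : ∀ θ, risk A (h θ) μ ≤ B) :
    Fintype.card J * (p * q ^ n * 4⁻¹) ≤ B := by
  set P : Measure (Fin n → unitCube d) := Measure.pi fun _ => μ
  set F : (J → Fin 2) → (Fin n → unitCube d) → ℝ≥0∞ := fun θ x =>
    eLpNorm (fun y => A (fun i => (x i, h θ (x i))) y - ((h θ y : ℕ) : ℝ)) 2 μ ^ 2 with hF
  set G : (J → Fin 2) → (Fin n → unitCube d) → J → ℝ≥0∞ := fun θ x j =>
    ∫⁻ y, ‖A (fun i => (x i, h θ (x i))) y - ((h θ y : ℕ) : ℝ)‖ₑ ^ 2 ∂(ν j) with hG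
  set E : J → Set (Fin n → unitCube d) := fun j => univ.pi fun _ => W j
  have hE : ∀ j, MeasurableSet (E j) := fun j => MeasurableSet.univ_pi fun _ => hW j
  have hFmeas : ∀ θ, Measurable (F θ) := fun θ =>
    (risk_eq_lintegral hA (hh θ) hK hμ).1.comp
      (measurable_pi_lambda _ fun i =>
        (measurable_id.prodMk (hh θ)).comp (measurable_pi_apply i))
  have hFG : ∀ θ x, p * ∑ j, G θ x j ≤ F θ x := fun θ x => by
    simp only [hF, eLpNorm_two_sq]
    refine le_trans (le_of_eq ?_) (lintegral_mono' hνμ le_rfl)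
    rw [lintegral_smul_measure, lintegral_finsetSum_measure, smul_eq_mul]
  have hpair : ∀ θ j, ∀ x ∈ E j,
      (2 : ℝ≥0∞)⁻¹ ≤ G θ x j + G (Function.update θ j (1 - θ j)) x j := by
    intro θ j x hx
    have hne : θ j ≠ Function.update θ j (1 - θ j) j := by
      rw [Function.update_self]
      generalize θ j = u
      fin_cases u <;> decide
    -- On `E j` every sample point lies in `W j`, so flipping bit `j` leaves the labelled sample,
    -- and hence the output of `A`, unchanged.
    have hs : (fun i => (x i, h (Function.update θ j (1 - θ j)) (x i)))
        = fun i => (x i, h θ (x i)) := by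
      funext i
      rw [hagree θ j _ (x i) (hx i (mem_univ i))]
    simp only [hG, hs]
    have hm : Measurable fun y => ‖A (fun i => (x i, h θ (x i))) y - ((h θ y : ℕ) : ℝ)‖ₑ ^ 2 :=
      ((Lp.stronglyMeasurable _).measurable.sub
        ((measurable_of_countable (fun u : Fin 2 => ((u : ℕ) : ℝ))).comp (hh θ))).enorm.pow_const 2
    rw [← lintegral_add_left hm]
    calc (2 : ℝ≥0∞)⁻¹ = ∫⁻ _, (2 : ℝ≥0∞)⁻¹ ∂(ν j) := by simp
      _ ≤ _ := lintegral_mono_ae ((hflip θ _ j hne).mono fun y hy =>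
          half_le_enorm_sq_add_of_ne _ hy)
  have hsum : ∀ j, ∀ x ∈ E j, (Fintype.card (J → Fin 2) : ℝ≥0∞) * 4⁻¹ ≤ ∑ θ, G θ x j := by
    intro j x hx
    -- Flipping bit `j` permutes the hypercube, so summing the pair bound over all `θ` counts each
    -- `G θ x j` twice.
    let e : (J → Fin 2) ≃ (J → Fin 2) := Function.Involutive.toPerm
      (fun θ => Function.update θ j (1 - θ j)) fun θ => by
        funext i
        by_cases hi : i = j
        · subst hi; simp
        · simp [hi]
    have h2 : ∑ θ, G (Function.update θ j (1 - θ j)) x j = ∑ θ, G θ x j :=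
      e.sum_comp fun θ => G θ x j
    have h3 : (Fintype.card (J → Fin 2) : ℝ≥0∞) * 2⁻¹ ≤ 2 * ∑ θ, G θ x j := by
      calc (Fintype.card (J → Fin 2) : ℝ≥0∞) * 2⁻¹ = ∑ _θ : J → Fin 2, (2 : ℝ≥0∞)⁻¹ := by simp
        _ ≤ ∑ θ, (G θ x j + G (Function.update θ j (1 - θ j)) x j) :=
            Finset.sum_le_sum fun θ _ => hpair θ j x hx
        _ = _ := by rw [Finset.sum_add_distrib, h2, two_mul]
    have h4 : (4 : ℝ≥0∞)⁻¹ = 2⁻¹ * 2⁻¹ := by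
      rw [← ENNReal.mul_inv (by simp) (by simp)]; norm_num
    rw [h4, ← mul_assoc]
    calc _ ≤ (2 * ∑ θ, G θ x j) * 2⁻¹ := by gcongr
      _ = _ := by
        rw [mul_comm 2, mul_assoc, ENNReal.mul_inv_cancel (by simp) (by simp), mul_one]
  set N : ℝ≥0∞ := (Fintype.card (J → Fin 2) : ℝ≥0∞) with hN
  have hpt : ∀ x, ∑ j, (E j).indicator (fun _ => p * (N * 4⁻¹)) x ≤ ∑ θ, F θ x := fun x =>
    calc _ ≤ ∑ j, p * ∑ θ, G θ x j := Finset.sum_le_sum fun j _ => by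
          by_cases hx : x ∈ E j
          · rw [indicator_of_mem hx]
            gcongr
            exact hsum j x hx
          · rw [indicator_of_notMem hx]; exact zero_le
      _ = ∑ θ, p * ∑ j, G θ x j := by
          rw [← Finset.mul_sum, ← Finset.mul_sum, Finset.sum_comm]
      _ ≤ _ := Finset.sum_le_sum fun θ _ => hFG θ x
  have hPE : ∀ j, q ^ n ≤ P (E j) := fun j => by
    rw [Measure.pi_pi]
    simp only [Finset.prod_const, Finset.card_univ, Fintype.card_fin]
    exact pow_le_pow_left₀ zero_le (hq j) n
  -- The worst case over `θ` dominates the uniform average; both sides carry the number `N` of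
  -- vertices to avoid dividing.
  have hint : N * (Fintype.card J * (p * q ^ n * 4⁻¹)) ≤ N * B :=
    calc N * (Fintype.card J * (p * q ^ n * 4⁻¹))
        = ∑ _j : J, p * (N * 4⁻¹) * q ^ n := by
          rw [Finset.sum_const, Finset.card_univ, nsmul_eq_mul]; ring
      _ ≤ ∑ j, p * (N * 4⁻¹) * P (E j) := Finset.sum_le_sum fun j _ => by
          gcongr
          exact hPE j
      _ = ∫⁻ x, ∑ j, (E j).indicator (fun _ => p * (N * 4⁻¹)) x ∂P := by
          rw [lintegral_finsetSum _ fun j _ => measurable_const.indicator (hE j)]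
          exact Finset.sum_congr rfl fun j _ => (lintegral_indicator_const (hE j) _).symm
      _ ≤ ∫⁻ x, ∑ θ, F θ x ∂P := lintegral_mono hpt
      _ = ∑ θ, risk A (h θ) μ := by
          rw [lintegral_finsetSum _ fun θ _ => hFmeas θ]
          exact Finset.sum_congr rfl fun θ _ => (risk_eq_lintegral hA (hh θ) hK hμ).2.symm
      _ ≤ ∑ _θ : J → Fin 2, B := Finset.sum_le_sum fun θ _ => hB θ
      _ = N * B := by simp [hN]
  refine (ENNReal.mul_le_mul_iff_right ?_ ?_).1 hint
  · exact Nat.cast_ne_zero.2 Fintype.card_ne_zero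
  · exact ENNReal.natCast_ne_top _

/-! ### Lebesgue measure on the cube and bounded densities. -/

theorem isCompact_unitCube (d : ℕ) : IsCompact (unitCube d) := by
  have h := (isCompact_univ_pi fun _ : Fin d => isCompact_Icc (a := (0 : ℝ)) (b := 1)).image
    (PiLp.continuous_toLp 2 fun _ : Fin d => ℝ)
  convert h using 1
  ext x
  constructor
  · intro hx
    exact ⟨x.ofLp, fun i _ => hx i, rfl⟩
  · rintro ⟨z, hz, rfl⟩ i
    exact hz i (mem_univ i)

theorem cubeVolume_apply (d : ℕ) (s : Set (unitCube d)) :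
    cubeVolume d s = volume (Subtype.val '' s) :=
  (MeasurableEmbedding.subtype_coe (isCompact_unitCube d).measurableSet).comap_apply _ _

instance isFiniteMeasure_cubeVolume (d : ℕ) : IsFiniteMeasure (cubeVolume d) :=
  ⟨by
    rw [cubeVolume_apply, image_univ, Subtype.range_coe]
    exact (isCompact_unitCube d).measure_lt_top⟩

/-- Balls around points with all coordinates in `(0, 1)` have positive volume. -/
theorem cubeVolume_ball_ne_zero {d : ℕ} {y : unitCube d} (hy : ∀ i, y.1 i ∈ Ioo (0 : ℝ) 1)
    {ρ : ℝ} (hρ : 0 < ρ) : cubeVolume d (Metric.ball y ρ) ≠ 0 := by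
  set U : Set (EuclideanSpace ℝ (Fin d)) := (⋂ i, {x | x i ∈ Ioo (0 : ℝ) 1}) ∩ Metric.ball y.1 ρ
  have hU : IsOpen U := by
    refine (isOpen_iInter_of_finite fun i => ?_).inter Metric.isOpen_ball
    exact isOpen_Ioo.preimage (by fun_prop : Continuous fun x : EuclideanSpace ℝ (Fin d) => x i)
  have hyU : y.1 ∈ U := ⟨mem_iInter.2 hy, Metric.mem_ball_self hρ⟩
  have hsub : U ⊆ Subtype.val '' Metric.ball y ρ := fun x hx =>
    ⟨⟨x, fun i => Ioo_subset_Icc_self (mem_iInter.1 hx.1 i)⟩, hx.2, rfl⟩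
  rw [cubeVolume_apply]
  exact ((hU.measure_pos volume ⟨_, hyU⟩).trans_le (measure_mono hsub)).ne'

/-- Domination by `K • cubeVolume d` forces the Radon–Nikodym derivative to be at most `K` almost
everywhere, so its real part is the required density. -/
theorem mem_boundedDensityMeasures_of_le {d : ℕ} {μ : Measure (unitCube d)}
    [IsProbabilityMeasure μ] {K : ℝ≥0∞} (hK : K ≠ ∞) (hμ : μ ≤ K • cubeVolume d) :
    μ ∈ boundedDensityMeasures d := by
  have hac : μ ≪ cubeVolume d := Measure.absolutelyContinuous_of_le_smul hμ
  refine ⟨fun x => (μ.rnDeriv (cubeVolume d) x).toReal, fun x => ENNReal.toReal_nonneg, ?_, ?_, ?_⟩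
  · have hle : μ.rnDeriv (cubeVolume d) ≤ᵐ[cubeVolume d] fun _ => K := by
      refine ae_le_of_forall_setLIntegral_le_of_sigmaFinite (Measure.measurable_rnDeriv _ _)
        fun s _ _ => ?_
      calc _ ≤ μ s := Measure.setLIntegral_rnDeriv_le s
        _ ≤ (K • cubeVolume d) s := hμ s
        _ = _ := by simp
    refine memLp_top_of_bound (Measure.measurable_rnDeriv _ _).ennreal_toReal.aestronglyMeasurable
      K.toReal (hle.mono fun x hx => ?_)
    rw [Real.norm_of_nonneg ENNReal.toReal_nonneg]
    exact ENNReal.toReal_mono hK hx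
  · rw [Measure.integral_toReal_rnDeriv hac, probReal_univ]
  · conv_lhs => rw [← Measure.withDensity_rnDeriv_eq μ (cubeVolume d) hac]
    refine withDensity_congr_ae ?_
    filter_upwards [Measure.rnDeriv_lt_top μ (cubeVolume d)] with x hx
    rw [ENNReal.ofReal_toReal hx.ne]

/-! ### Coordinates, decision boundaries and labels near a point. -/

theorem continuous_baseCoord {k : ℕ} : Continuous (baseCoord (k := k)) := by
  unfold baseCoord
  refine Continuous.subtype_mk ?_ _
  exact (PiLp.continuous_toLp 2 _).comp (by fun_prop)

theorem continuous_lastCoord {k : ℕ} : Continuous (lastCoord (k := k)) := by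
  unfold lastCoord
  fun_prop

/-- The point of the cube with base coordinates `z` and last coordinate `t`. -/
def cubeSnoc {k : ℕ} (z : unitCube k) (t : Icc (0 : ℝ) 1) : unitCube (k + 1) :=
  ⟨WithLp.toLp 2 (Fin.snoc (α := fun _ => ℝ) z.1 t), fun i => by
    refine Fin.lastCases ?_ (fun j => ?_) i
    · simp
    · simpa using z.2 j⟩

theorem baseCoord_cubeSnoc {k : ℕ} (z : unitCube k) (t : Icc (0 : ℝ) 1) :
    baseCoord (cubeSnoc z t) = z := by
  apply Subtype.ext
  ext j
  simp [baseCoord, cubeSnoc]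

theorem lastCoord_cubeSnoc {k : ℕ} (z : unitCube k) (t : Icc (0 : ℝ) 1) :
    lastCoord (cubeSnoc z t) = t := by
  simp [lastCoord, cubeSnoc]

theorem cubeSnoc_mem_Ioo {k : ℕ} {z : unitCube k} {t : Icc (0 : ℝ) 1}
    (hz : ∀ i, z.1 i ∈ Ioo (0 : ℝ) 1) (ht : (t : ℝ) ∈ Ioo (0 : ℝ) 1) (i : Fin (k + 1)) :
    (cubeSnoc z t).1 i ∈ Ioo (0 : ℝ) 1 := by
  refine Fin.lastCases ?_ (fun j => ?_) i
  · simpa [cubeSnoc] using ht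
  · simpa [cubeSnoc] using hz j

theorem isClosed_decisionBoundary {k : ℕ} {b : unitCube k → ℝ} (hb : Continuous b) :
    IsClosed (decisionBoundary b) :=
  isClosed_eq (hb.comp continuous_baseCoord) continuous_lastCoord

theorem decisionBoundary_nonempty {k : ℕ} {b : unitCube k → ℝ} (hb : ∀ z, b z ∈ Icc (0 : ℝ) 1) :
    (decisionBoundary b).Nonempty := by
  let z : unitCube k := ⟨0, fun i => by simp⟩
  exact ⟨cubeSnoc z ⟨b z, hb z⟩, by
    simp [decisionBoundary, baseCoord_cubeSnoc, lastCoord_cubeSnoc]⟩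

theorem measurable_horizon {k : ℕ} {b : unitCube k → ℝ} (hb : Continuous b) :
    Measurable (horizon b) := by
  classical
  unfold horizon
  exact Measurable.ite (isClosed_le (hb.comp continuous_baseCoord)
    continuous_lastCoord).measurableSet measurable_const measurable_const

/-- Away from the graph of `b`, small balls keep their distance to the decision boundary and have
a constant label. -/
theorem exists_ball_away {k : ℕ} {b : unitCube k → ℝ} (hb : Continuous b)
    (hb01 : ∀ z, b z ∈ Icc (0 : ℝ) 1) {y : unitCube (k + 1)}
    (hy : b (baseCoord y) ≠ lastCoord y) :
    ∃ δ > 0, ∀ ρ ≤ δ, ∀ x ∈ Metric.ball y ρ,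
      ρ ≤ Metric.infDist x (decisionBoundary b) ∧ horizon b x = horizon b y := by
  have hpos : 0 < Metric.infDist y (decisionBoundary b) :=
    ((isClosed_decisionBoundary hb).notMem_iff_infDist_pos (decisionBoundary_nonempty hb01)).1 hy
  have hcb := hb.comp continuous_baseCoord
  obtain ⟨ε, hε, hconst⟩ : ∃ ε > 0, ∀ x ∈ Metric.ball y ε, horizon b x = horizon b y := by
    rcases hy.lt_or_gt with h | h
    · obtain ⟨ε, hε, hsub⟩ := Metric.isOpen_iff.1 (isOpen_lt hcb continuous_lastCoord) y h
      refine ⟨ε, hε, fun x hx => ?_⟩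
      have hx' : b (baseCoord x) < lastCoord x := hsub hx
      rw [horizon, horizon, if_pos hx'.le, if_pos h.le]
    · obtain ⟨ε, hε, hsub⟩ := Metric.isOpen_iff.1 (isOpen_lt continuous_lastCoord hcb) y h
      refine ⟨ε, hε, fun x hx => ?_⟩
      have hx' : lastCoord x < b (baseCoord x) := hsub hx
      rw [horizon, horizon, if_neg hx'.not_ge, if_neg h.not_ge]
  -- With `D` the distance of `y` to the boundary and `ρ ≤ D / 2`, points of the ball keep distance
  -- at least `D - ρ ≥ ρ`.
  refine ⟨min ε (Metric.infDist y (decisionBoundary b) / 2), lt_min hε (half_pos hpos),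
    fun ρ hρ x hx => ⟨?_, hconst x (Metric.ball_subset_ball (hρ.trans (min_le_left _ _)) hx)⟩⟩
  have h1 := Metric.infDist_le_infDist_add_dist (s := decisionBoundary b) (x := y) (y := x)
  have h2 := hρ.trans (min_le_right _ _)
  rw [dist_comm] at h1
  have h3 := Metric.mem_ball.1 hx
  linarith

/-! ### From anchor points to a minimax bound. -/

/-- A minimax lower bound from a hypercube of boundary functions whose labels at finitely many
anchor points are all different from the boundary values. -/
theorem le_minimaxRisk_of_anchors {k n : ℕ} {𝒞 : Set (unitCube k → ℝ)} {γ : ℝ} (hγ : 0 ≤ γ)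
    (h𝒞 : IsHorizonClass 𝒞) {J : Type*} [Fintype J] {b : (J → Fin 2) → unitCube k → ℝ}
    (hb : ∀ θ, b θ ∈ 𝒞) {y : Option J → unitCube (k + 1)}
    (hy : ∀ l i, (y l).1 i ∈ Ioo (0 : ℝ) 1)
    (hnone : ∀ θ, lastCoord (y none) < b θ (baseCoord (y none)))
    (hzero : ∀ θ j, θ j = 0 → b θ (baseCoord (y (some j))) < lastCoord (y (some j)))
    (hone : ∀ θ j, θ j = 1 → lastCoord (y (some j)) < b θ (baseCoord (y (some j))))
    {p : ℝ≥0∞} (hp : Fintype.card J * p ≤ 1) :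
    Fintype.card J * (p * (1 - p) ^ n * 4⁻¹) ≤ minimaxRisk n 𝒞 γ := by
  classical
  have hbc : ∀ θ, Continuous (b θ) := fun θ => (h𝒞 _ (hb θ)).1
  have hlab : ∀ θ j, horizon (b θ) (y (some j)) = 1 - θ j := fun θ j => by
    rcases (by omega : θ j = 0 ∨ θ j = 1) with h | h
    · rw [horizon, if_pos (hzero θ j h).le, h]; rfl
    · rw [horizon, if_neg (hone θ j h).not_ge, h]; rfl
  have hlab0 : ∀ θ, horizon (b θ) (y none) = 0 := fun θ => by
    rw [horizon, if_neg (hnone θ).not_ge]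
  have hoff : ∀ θ l, b θ (baseCoord (y l)) ≠ lastCoord (y l) := by
    rintro θ (_ | j)
    · exact (hnone θ).ne'
    · rcases (by omega : θ j = 0 ∨ θ j = 1) with h | h
      · exact (hzero θ j h).ne
      · exact (hone θ j h).ne'
  -- One radius works for all `θ` and all anchors, because there are finitely many such pairs.
  obtain ⟨ρ, hρ, hball⟩ : ∃ ρ > 0, ∀ θ l, ∀ x ∈ Metric.ball (y l) ρ,
      ρ ≤ Metric.infDist x (decisionBoundary (b θ)) ∧
        horizon (b θ) x = horizon (b θ) (y l) := by
    choose δ hδ hδball using fun θ l => exists_ball_away (hbc θ) (h𝒞 _ (hb θ)).2 (hoff θ l)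
    obtain ⟨q, hq⟩ := Finite.exists_min fun q : (J → Fin 2) × Option J => δ q.1 q.2
    exact ⟨δ q.1 q.2, hδ _ _, fun θ l => hδball θ l _ (hq (θ, l))⟩
  set V : Option J → Set (unitCube (k + 1)) := fun l => Metric.ball (y l) ρ
  have hV : ∀ l, MeasurableSet (V l) := fun l => Metric.isOpen_ball.measurableSet
  have hV0 : ∀ l, cubeVolume (k + 1) (V l) ≠ 0 := fun l => cubeVolume_ball_ne_zero (hy l) hρ
  set ν : Option J → Measure (unitCube (k + 1)) := fun l =>
    ProbabilityTheory.cond (cubeVolume (k + 1)) (V l) with hνdef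
  have hν : ∀ l, IsProbabilityMeasure (ν l) := fun l =>
    ProbabilityTheory.cond_isProbabilityMeasure (hV0 l)
  have hνV : ∀ l, ∀ᵐ x ∂(ν l), x ∈ V l := fun l => ProbabilityTheory.ae_cond_mem (hV l)
  have hνV1 : ∀ l, ν l (V l) = 1 := fun l => by
    rw [← prob_compl_eq_zero_iff (hV l)]; exact hνV l
  -- The anchor `none` absorbs the mass not used by the bit anchors; its label carries no
  -- information on `θ`.
  set w : Option J → ℝ≥0∞ := fun l => l.elim (1 - Fintype.card J * p) fun _ => p with hw
  have hw1 : ∑ l, w l = 1 := by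
    rw [Fintype.sum_option]
    simp only [hw, Option.elim, Finset.sum_const, Finset.card_univ, nsmul_eq_mul]
    exact tsub_add_cancel_of_le hp
  have hwtop : ∀ l, w l ≠ ∞ := fun l =>
    ((Finset.single_le_sum (fun _ _ => zero_le) (Finset.mem_univ l)).trans hw1.le).trans_lt
      ENNReal.one_lt_top |>.ne
  set μ : Measure (unitCube (k + 1)) := ∑ l, w l • ν l with hμdef
  have hμapp : ∀ s, μ s = ∑ l, w l * ν l s := fun s => by
    simp [hμdef]
  have hμprob : IsProbabilityMeasure μ := ⟨by rw [hμapp]; simp [hw1]⟩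
  set K : ℝ≥0∞ := ∑ l, w l * (cubeVolume (k + 1) (V l))⁻¹
  have hK : K ≠ ∞ := by
    refine ENNReal.sum_ne_top.2 fun l _ => ENNReal.mul_ne_top (hwtop l) ?_
    exact ENNReal.inv_ne_top.2 (hV0 l)
  have hμK : μ ≤ K • cubeVolume (k + 1) := Measure.le_iff.2 fun s hs => by
    rw [hμapp, Measure.smul_apply, smul_eq_mul, Finset.sum_mul]
    refine Finset.sum_le_sum fun l _ => ?_
    rw [hνdef, ProbabilityTheory.cond_apply (hV l), mul_assoc]
    gcongr
    exact inter_subset_right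
  have hmargin : ∀ θ, MarginCondition γ (b θ) μ := fun θ => by
    refine ⟨ρ ^ (-γ), Real.rpow_pos_of_pos hρ _, fun ε hε => ?_⟩
    -- For `ε < ρ` the neighbourhood of the boundary is `μ`-null; for `ε ≥ ρ` the bound `(ε / ρ) ^
    -- γ` is at least `1`.
    rcases lt_or_ge ε ρ with h | h
    · suffices hz : μ {x | Metric.infDist x (decisionBoundary (b θ)) ≤ ε} = 0 by
        rw [hz]; exact zero_le
      rw [hμapp]
      refine Finset.sum_eq_zero fun l _ => ?_
      rw [measure_eq_zero_iff_ae_notMem.2 ((hνV l).mono fun x hx => ?_), mul_zero]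
      exact fun hx' => absurd ((hball θ l x hx).1.trans hx') h.not_ge
    · refine prob_le_one.trans ?_
      rw [ENNReal.one_le_ofReal, Real.rpow_neg hρ.le, inv_mul_eq_div,
        one_le_div (Real.rpow_pos_of_pos hρ _)]
      exact Real.rpow_le_rpow hρ.le h hγ
  -- Labels on these balls do not depend on bit `j`. The balls other than ball `j` carry total
  -- weight `1 - p`, and no disjointness has to be checked.
  set W : J → Set (unitCube (k + 1)) := fun j => ⋃ l ≠ some j, V l
  have hW : ∀ j, MeasurableSet (W j) := fun j =>
    MeasurableSet.iUnion fun l => MeasurableSet.iUnion fun _ => hV l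
  refine le_iInf₂ fun A hA => ?_
  refine assouad_noiseless hA (h := fun θ => horizon (b θ)) (fun θ => measurable_horizon (hbc θ))
    (μ := μ) hK hμK (ν := fun j => ν (some j)) (fun j => hν _) ?_ ?_ (W := W) hW ?_ ?_ ?_
  · rw [hμdef, Fintype.sum_option, Finset.smul_sum]
    exact Measure.le_add_left le_rfl
  · intro θ θ' j hne
    refine (hνV (some j)).mono fun x hx => ?_
    rw [(hball θ _ x hx).2, (hball θ' _ x hx).2, hlab, hlab]
    exact fun h => hne (sub_right_injective h)
  · intro j
    rw [tsub_le_iff_right, ← hw1, hμapp, ← Finset.add_sum_erase _ _ (Finset.mem_univ (some j)),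
      add_comm]
    refine add_le_add ?_ (le_refl p)
    calc ∑ l ∈ Finset.univ.erase (some j), w l
        = ∑ l ∈ Finset.univ.erase (some j), w l * ν l (W j) := by
          refine Finset.sum_congr rfl fun l hl => ?_
          have hsub : V l ⊆ W j := subset_iUnion₂_of_subset l (Finset.ne_of_mem_erase hl) le_rfl
          rw [le_antisymm prob_le_one ((hνV1 l).symm.le.trans (measure_mono hsub)), mul_one]
      _ ≤ _ := Finset.sum_le_sum_of_subset (Finset.erase_subset _ _)
  · intro θ j u x hx
    simp only [W, mem_iUnion] at hx
    obtain ⟨l, hl, hx⟩ := hx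
    rw [(hball _ l x hx).2, (hball θ l x hx).2]
    cases l with
    | none => rw [hlab0, hlab0]
    | some i =>
      rw [hlab, hlab, Function.update_of_ne]
      exact fun h => hl (congrArg some h)
  · intro θ
    exact le_iSup₂_of_le (horizon (b θ), μ) ⟨b θ, hb θ, rfl,
      mem_boundedDensityMeasures_of_le hK hμK, hmargin θ⟩ le_rfl

/-! ### The odd grid and the perturbed boundaries. -/

theorem card_filter_odd_Icc (t : ℕ) : ((Finset.Icc 1 (2 * t)).filter Odd).card = t := by
  induction t with
  | zero => simp
  | succ t ih =>
    have h1 : Finset.Icc 1 (2 * (t + 1)) =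
        insert (2 * t + 2) (insert (2 * t + 1) (Finset.Icc 1 (2 * t))) := by
      ext i
      simp only [Finset.mem_Icc, Finset.mem_insert]
      omega
    rw [h1, Finset.filter_insert, if_neg (by rw [Nat.not_odd_iff_even]; exact ⟨t + 1, by ring⟩),
      Finset.filter_insert, if_pos ⟨t, rfl⟩, Finset.card_insert_of_notMem (by simp), ih]

theorem card_oddGrid (k t : ℕ) : (oddGrid k (2 * t)).card = t ^ k := by
  simp [oddGrid, Fintype.card_piFinset, card_filter_odd_Icc]

section Perturbation

variable {k : ℕ} {𝒞 : Set (unitCube k → ℝ)} {α : ℝ} {M : ℕ} {b₀ : unitCube k → ℝ}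
  {φ : EuclideanSpace ℝ (Fin k) → ℝ} {Kφ Cφ C : ℝ}

namespace IsPerturbationData

theorem bump_eq_zero (hd : IsPerturbationData 𝒞 α M b₀ φ Kφ Cφ C)
    {z : EuclideanSpace ℝ (Fin k)} {i : Fin k} (hz : 1 ≤ |z i|) : φ z = 0 := by
  by_contra h
  have := hd.tsupport_subset (subset_tsupport φ h) i
  exact absurd (abs_lt.2 this) hz.not_gt

/-- In positive dimension the Hölder constant at `0` is at least `1`, since the bump drops from
`1` to `0` within distance `1`. -/
theorem one_le_Cφ (hd : IsPerturbationData 𝒞 α M b₀ φ Kφ Cφ C) (hk : 1 ≤ k) : 1 ≤ Cφ := by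
  let i₀ : Fin k := ⟨0, hk⟩
  have h0 : φ (EuclideanSpace.single i₀ (1 : ℝ)) = 0 :=
    hd.bump_eq_zero (i := i₀) (by simp)
  have h := hd.holder_zero (EuclideanSpace.single i₀ (1 : ℝ))
  have hn : ‖WithLp.ofLp (EuclideanSpace.single i₀ (1 : ℝ))‖ = 1 := by
    simp [Pi.norm_single]
  rw [h0, hd.map_zero, hn, Real.one_rpow] at h
  simpa using h

/-- The base is at least `2` and the exponent at most `-1`. This lets `r ^ k` be absorbed by the
factor `2 ^ (-k)` from the size `(M / 2) ^ k` of the grid. -/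
theorem radius_le_half (hd : IsPerturbationData 𝒞 α M b₀ φ Kφ Cφ C) (hk : 1 ≤ k)
    (hα : α ∈ Ioc (0 : ℝ) 1) : (2 * Cφ) ^ (-1 / α) ≤ 1 / 2 := by
  have hC := hd.one_le_Cφ hk
  have hexp : -1 / α ≤ -1 := by
    rw [div_le_iff₀ hα.1]
    linarith [hα.2]
  calc (2 * Cφ) ^ (-1 / α) ≤ (2 * Cφ) ^ (-1 : ℝ) :=
        Real.rpow_le_rpow_of_exponent_le (by linarith) hexp
    _ = (2 * Cφ)⁻¹ := Real.rpow_neg_one _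
    _ ≤ 1 / 2 := by
        rw [← one_div]
        exact one_div_le_one_div_of_le two_pos (by linarith)

theorem amplitude_le_quarter (hd : IsPerturbationData 𝒞 α M b₀ φ Kφ Cφ C) (hα : 0 < α) :
    C ≤ 1 / 4 := by
  have hM : (1 : ℝ) ≤ M := by exact_mod_cast one_le_two.trans hd.two_le_M
  have := Real.rpow_le_one_of_one_le_of_nonpos hM (neg_nonpos.2 hα.le)
  linarith [hd.amplitude_le]

theorem le_perturbed (hd : IsPerturbationData 𝒞 α M b₀ φ Kφ Cφ C) (θ : oddGrid k M → Fin 2)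
    (z : unitCube k) : C ≤ perturbed M b₀ φ C θ z := by
  have h : 0 ≤ ∑ v : oddGrid k M, ((θ v : ℕ) : ℝ) * (C * localBump M φ v.1 z) :=
    Finset.sum_nonneg fun v _ => mul_nonneg (Nat.cast_nonneg _)
      (mul_nonneg hd.amplitude_pos.le (hd.range_mem _).1)
  have := (hd.baseline_range z).1
  unfold perturbed
  linarith

/-- Two distinct grid points, rescaled by `M`, differ by at least `1` in some coordinate, which is
outside the support of `φ`; only the bump centred at `v` survives. -/
theorem perturbed_of_grid (hd : IsPerturbationData 𝒞 α M b₀ φ Kφ Cφ C)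
    (θ : oddGrid k M → Fin 2) (v : oddGrid k M) {z : unitCube k}
    (hz : ∀ i, z.1 i = (v.1 i : ℝ) / M) :
    perturbed M b₀ φ C θ z = b₀ z + ((θ v : ℕ) : ℝ) * C := by
  have hM : (M : ℝ) ≠ 0 := by
    have := hd.two_le_M
    exact_mod_cast (by omega : M ≠ 0)
  have hself : localBump M φ v.1 z = 1 := by
    rw [← hd.map_zero, localBump]
    congr 1
    ext i
    simp [hz]
  have hother : ∀ u : oddGrid k M, u ≠ v → localBump M φ u.1 z = 0 := fun u hu => by
    obtain ⟨i, hi⟩ := Function.ne_iff.1 fun h => hu (Subtype.ext h)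
    refine hd.bump_eq_zero (i := i) ?_
    have he : (M : ℝ) * (z.1 i - (u.1 i : ℝ) / M) = ((v.1 i - u.1 i : ℤ) : ℝ) := by
      rw [hz]
      push_cast
      field_simp
    simp only [he]
    have : (1 : ℤ) ≤ |(v.1 i - u.1 i : ℤ)| := Int.one_le_abs (by omega)
    exact_mod_cast this
  rw [perturbed, Fintype.sum_eq_single v fun u hu => by rw [hother u hu]; ring, hself, mul_one]

end IsPerturbationData

end Perturbation

/-! ### Choice of the anchors and of the mass `p`. -/

theorem IsPerturbationData.le_minimaxRisk {k : ℕ} {𝒞 : Set (unitCube k → ℝ)} {α γ : ℝ} {M : ℕ}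
    {b₀ : unitCube k → ℝ} {φ : EuclideanSpace ℝ (Fin k) → ℝ} {Kφ Cφ C : ℝ}
    (hd : IsPerturbationData 𝒞 α M b₀ φ Kφ Cφ C) (hα : 0 < α) (hγ : 0 ≤ γ)
    (h𝒞 : IsHorizonClass 𝒞) (hsub : perturbedFamily M b₀ φ C ⊆ 𝒞) (n : ℕ) {p : ℝ≥0∞}
    (hp : (oddGrid k M).card * p ≤ 1) :
    (oddGrid k M).card * (p * (1 - p) ^ n * 4⁻¹) ≤ minimaxRisk n 𝒞 γ := by
  have hC := hd.amplitude_pos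
  have hC4 := hd.amplitude_le_quarter hα
  have hM : (0 : ℝ) < M := by
    have := hd.two_le_M
    exact_mod_cast (by omega : 0 < M)
  have hgrid : ∀ v : oddGrid k M, ∀ i, (v.1 i : ℝ) / M ∈ Ioo (0 : ℝ) 1 := fun v i => by
    obtain ⟨h1, h2⟩ := Finset.mem_filter.1 (Fintype.mem_piFinset.1 v.2 i)
    rw [Finset.mem_Icc] at h1
    -- Parity keeps the anchors off the face where a coordinate equals `1`; balls around interior
    -- points have positive volume.
    have h3 : v.1 i ≠ M := fun h => Nat.not_even_iff_odd.2 (h ▸ h2) hd.even_M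
    constructor
    · exact div_pos (by exact_mod_cast h1.1) hM
    · rw [div_lt_one hM]
      exact_mod_cast lt_of_le_of_ne h1.2 h3
  let z : oddGrid k M → unitCube k := fun v =>
    ⟨WithLp.toLp 2 fun i => (v.1 i : ℝ) / M, fun i => Ioo_subset_Icc_self (hgrid v i)⟩
  let z₀ : unitCube k := ⟨WithLp.toLp 2 fun _ => 1 / 2, fun _ => by norm_num⟩
  have ht : ∀ v, b₀ (z v) + C / 2 ∈ Ioo (0 : ℝ) 1 := fun v => by
    have := hd.baseline_range (z v)
    constructor <;> linarith [this.1, this.2]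
  have ht₀ : C / 2 ∈ Ioo (0 : ℝ) 1 := ⟨by linarith, by linarith⟩
  -- Height `C / 2` is below every perturbed graph, all of which stay above `C`; height `b₀ + C / 2`
  -- is midway between the values for bits `0` and `1`.
  let y : Option (oddGrid k M) → unitCube (k + 1) := fun l =>
    l.elim (cubeSnoc z₀ ⟨C / 2, Ioo_subset_Icc_self ht₀⟩)
      fun v => cubeSnoc (z v) ⟨b₀ (z v) + C / 2, Ioo_subset_Icc_self (ht v)⟩
  have key := le_minimaxRisk_of_anchors (n := n) hγ h𝒞 (b := perturbed M b₀ φ C) (y := y) (p := p)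
    (fun θ => hsub ⟨θ, rfl⟩) ?_ ?_ ?_ ?_ (by simpa using hp)
  · simpa using key
  · rintro (_ | v) i
    · exact cubeSnoc_mem_Ioo (fun _ => by norm_num [z₀]) ht₀ i
    · exact cubeSnoc_mem_Ioo (hgrid v) (ht v) i
  · intro θ
    have := hd.le_perturbed θ z₀
    simp only [y, Option.elim, baseCoord_cubeSnoc, lastCoord_cubeSnoc]
    linarith
  · intro θ v h
    simp only [y, Option.elim, baseCoord_cubeSnoc, lastCoord_cubeSnoc]
    rw [hd.perturbed_of_grid θ v fun _ => rfl, h]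
    simp [hC]
  · intro θ v h
    simp only [y, Option.elim, baseCoord_cubeSnoc, lastCoord_cubeSnoc]
    rw [hd.perturbed_of_grid θ v fun _ => rfl, h]
    simp only [Fin.val_one, Nat.cast_one, one_mul]
    linarith

theorem theorem2p1 (k : ℕ) (hk : 1 ≤ k) (𝒞 : Set (unitCube k → ℝ)) (α γ : ℝ)
    (hα : α ∈ Set.Ioc (0 : ℝ) 1) (hγ : α ≤ γ)
    (h𝒞 : IsHorizonClass 𝒞) (hHolder : IsHolderClass 𝒞 α) (n : ℕ)
    (M : ℕ) (b₀ : unitCube k → ℝ) (φ : EuclideanSpace ℝ (Fin k) → ℝ) (Kφ Cφ C : ℝ)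
    (hdata : IsPerturbationData 𝒞 α M b₀ φ Kφ Cφ C)
    (hsub : perturbedFamily M b₀ φ C ⊆ 𝒞)
    (hn : (2 : ℝ) ^ (γ / α + 6) * (n : ℝ) * C ^ (γ / α) * ((M : ℝ) ^ k)⁻¹ ≤ 1) :
    ENNReal.ofReal
        ((min 1 ((2 * Cφ) ^ (-1 / α))) ^ k / (8 : ℝ) ^ (γ / α + 2) * C ^ (γ / α))
      ≤ minimaxRisk n 𝒞 γ := by
  have hg : 0 ≤ γ / α := div_nonneg (hα.1.le.trans hγ) hα.1.le
  set g := γ / α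
  obtain ⟨t, rfl⟩ := hdata.even_M.two_dvd
  have ht : (1 : ℝ) ≤ t := by
    have := hdata.two_le_M
    exact_mod_cast (by omega : 1 ≤ t)
  have htk : (0 : ℝ) < (t : ℝ) ^ k := by positivity
  have hC := hdata.amplitude_pos
  have hCg : 0 < C ^ g := Real.rpow_pos_of_pos hC g
  have hCg1 : C ^ g ≤ 1 :=
    Real.rpow_le_one hC.le (by linarith [hdata.amplitude_le_quarter hα.1]) hg
  -- With `t ^ k` grid points the bit anchors get total mass `C ^ g / 2 ^ k`, and the sample size
  -- hypothesis becomes `2 ^ (g + 6) * (n * p) ≤ 1`.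
  set p : ℝ := C ^ g * (((2 * t : ℕ) : ℝ) ^ k)⁻¹ with hp
  have hp0 : 0 ≤ p := by positivity
  have hmp : (t : ℝ) ^ k * p = C ^ g * (1 / 2) ^ k := by
    rw [hp]
    push_cast
    rw [mul_pow, one_div, inv_pow]
    field_simp
  have hhalf : ((1 : ℝ) / 2) ^ k ≤ 1 := pow_le_one₀ (by norm_num) (by norm_num)
  have hmp1 : (t : ℝ) ^ k * p ≤ 1 := by
    rw [hmp]
    exact mul_le_one₀ hCg1 (by positivity) hhalf
  have hp1 : p ≤ 1 := by
    have : 1 ≤ (t : ℝ) ^ k := one_le_pow₀ ht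
    nlinarith
  have hnp : n * p ≤ 1 / 2 := by
    have h64 : (2 : ℝ) ≤ 2 ^ (g + 6) := by
      calc (2 : ℝ) = 2 ^ (1 : ℝ) := (Real.rpow_one 2).symm
        _ ≤ _ := Real.rpow_le_rpow_of_exponent_le one_le_two (by linarith)
    have h : (2 : ℝ) ^ (g + 6) * (n * p) ≤ 1 := by
      rw [hp]
      linarith
    nlinarith [mul_nonneg n.cast_nonneg hp0]
  -- Bernoulli's inequality together with `n * p ≤ 1/2`.
  have hpow : 1 / 2 ≤ (1 - p) ^ n := by
    have := one_add_mul_le_pow (a := -p) (by linarith) n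
    rw [← sub_eq_add_neg] at this
    linarith
  -- Only a factor `8` is needed: `4` from Assouad's lemma and `2` from `hpow`.
  have h8 : (8 : ℝ) ≤ 8 ^ (g + 2) := by
    calc (8 : ℝ) = 8 ^ (1 : ℝ) := (Real.rpow_one 8).symm
      _ ≤ _ := Real.rpow_le_rpow_of_exponent_le (by norm_num) (by linarith)
  have hr : (min 1 ((2 * Cφ) ^ (-1 / α))) ^ k ≤ (1 / 2 : ℝ) ^ k := by
    have : 0 ≤ (2 * Cφ) ^ (-1 / α) := Real.rpow_nonneg (by linarith [hdata.Cφ_pos]) _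
    exact pow_le_pow_left₀ (le_min zero_le_one this)
      ((min_le_right _ _).trans (hdata.radius_le_half hk hα)) k
  have hreal : (min 1 ((2 * Cφ) ^ (-1 / α))) ^ k / (8 : ℝ) ^ (g + 2) * C ^ g
      ≤ (t : ℝ) ^ k * (p * (1 - p) ^ n * 4⁻¹) := by
    calc _ ≤ (1 / 2 : ℝ) ^ k / 8 * C ^ g := by gcongr
      _ = (t : ℝ) ^ k * p * (1 / 2) * 4⁻¹ := by rw [hmp]; ring
      _ ≤ (t : ℝ) ^ k * p * (1 - p) ^ n * 4⁻¹ := by gcongr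
      _ = _ := by ring
  have hcast : ((oddGrid k (2 * t)).card : ℝ≥0∞) = ENNReal.ofReal ((t : ℝ) ^ k) := by
    rw [card_oddGrid, ENNReal.ofReal_pow (by linarith), ENNReal.ofReal_natCast]
    push_cast
    rfl
  have hrisk := hdata.le_minimaxRisk hα.1 (hα.1.le.trans hγ) h𝒞 hsub n (p := ENNReal.ofReal p)
    (by rw [hcast, ← ENNReal.ofReal_mul htk.le, ENNReal.ofReal_le_one]; exact hmp1)
  refine le_trans ?_ hrisk
  have h1p : (1 : ℝ≥0∞) - ENNReal.ofReal p = ENNReal.ofReal (1 - p) := by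
    rw [ENNReal.ofReal_sub _ hp0, ENNReal.ofReal_one]
  have h4 : (4 : ℝ≥0∞)⁻¹ = ENNReal.ofReal (4⁻¹ : ℝ) := by
    rw [ENNReal.ofReal_inv_of_pos (by norm_num), ENNReal.ofReal_ofNat]
  rw [hcast, h1p, h4, ← ENNReal.ofReal_pow (by linarith), ← ENNReal.ofReal_mul hp0,
    ← ENNReal.ofReal_mul (mul_nonneg hp0 (pow_nonneg (by linarith) n)),
    ← ENNReal.ofReal_mul htk.le]
  exact ENNReal.ofReal_le_ofReal hreal
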